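/- Let $m\ge 1$ be an integer and $\wp$ an odd prime such that $3$ is a primitive root modulo $\wp^m$. Put $q=3^{\varphi(\wp^m)}$, where $\varphi$ is Euler's function, let $\mathrm{Tr}$ be the trace from $\mathbb F_q$ onto $\mathbb F_3$, and let $$D=\{x\in\mathbb F_q^*:\ \mathrm{Tr}(x^{(q-1)/\wp^m})=0\}=\{d_1,\dots,d_n\},\qquad n=|D|,$$ $$\mathcal C_D=\{(\mathrm{Tr}(d_1x),\dots,\mathrm{Tr}(d_nx)):\ x\in\mathbb F_q\}\subseteq\mathbb F_3^{\,n}.$$ For $i\ge 0$ let $A_i$ be the number of codewords of $\mathcal C_D$ of Hamming weight $i$; a code is called a two-weight code if exactly two of the numbers $A_1,A_2,\dots$ are nonzero. Then the following hold. (a) If $\wp\equiv 1\pmod 3$, then $\mathcal C_D$ is a two-weight ternary linear code of length $n=\frac{(q-1)(\wp^m-\wp+1)}{\wp^m}$ and dimension $(\wp-1)\wp^{m-1}$. Its two nonzero weights are $$w_1=\frac{2(\wp^m-\wp+1)q}{3\wp^m}-\frac{2(\wp-1)\sqrt q}{3\wp^m},\qquad w_2=\frac{2(\wp^m-\wp+1)q}{3\wp^m}+\frac{2(\wp^m-\wp+1)\sqrt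 q}{3\wp^m},$$ and $A_{w_1}=\frac{(\wp^m-\wp+1)(q-1)}{\wp^m}$, $A_{w_2}=\frac{(\wp-1)(q-1)}{\wp^m}$. (b) If $\wp\equiv -1\pmod 3$ and $m\ge 2$, then $\mathcal C_D$ is a two-weight ternary linear code of length $n=\frac{(q-1)(\wp^{m-1}-1)}{\wp^{m-1}}$ and dimension $(\wp-1)\wp^{m-1}$. Its two nonzero weights are $$w_1=\frac{2(\wp^{m-1}-1)q}{3\wp^{m-1}}+\frac{2(\wp^{m-1}-1)\sqrt q}{3\wp^{m-1}},\qquad w_2=\frac{2(\wp^{m-1}-1)q}{3\wp^{m-1}}-\frac{2\sqrt q}{3\wp^{m-1}},$$ and $A_{w_1}=\frac{q-1}{\wp^{m-1}}$, $A_{w_2}=\frac{(\wp^{m-1}-1)(q-1)}{\wp^{m-1}}$. -/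

import Mathlib

/-- The linear code attached to a list `d = (d₁, …, dₙ)` of elements of a finite field `F` of
characteristic `p`: it consists of the words `(Tr(d₁ x), …, Tr(dₙ x))`, `x ∈ F`, where `Tr` is the
absolute trace `F → 𝔽_p`. It is a subspace of `𝔽_p ^ n`. -/
noncomputable def traceCode (p : ℕ) {F : Type*} [Field F] [Algebra (ZMod p) F] {n : ℕ}
    (d : Fin n → F) : Submodule (ZMod p) (Fin n → ZMod p) :=
  LinearMap.range
    (LinearMap.pi fun i => (Algebra.trace (ZMod p) F).comp (LinearMap.mulLeft (ZMod p) (d i)))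

/-- The set `{x ∈ F^* : Tr(x ^ ((q - 1) / N)) = 0}`, where `q = |F|` and `Tr` is the trace from
`F` to `𝔽₃`. -/
def definingSet (F : Type*) [Field F] [Algebra (ZMod 3) F] (N : ℕ) : Set F :=
  {x | x ≠ 0 ∧ Algebra.trace (ZMod 3) F (x ^ ((Nat.card F - 1) / N)) = 0}

/-- The number `A_i` of codewords of Hamming weight `i` in the code `C`. -/
noncomputable def weightCount {p n : ℕ} (C : Submodule (ZMod p) (Fin n → ZMod p)) (i : ℕ) : ℕ :=
  Set.ncard {c : Fin n → ZMod p | c ∈ C ∧ hammingNorm c = i}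

/-- The set of positive integers `i` with `A_i ≠ 0`. -/
def positiveWeights {p n : ℕ} (C : Submodule (ZMod p) (Fin n → ZMod p)) : Set ℕ :=
  {i | 1 ≤ i ∧ weightCount C i ≠ 0}

/-- `C` is a `t`-weight code: exactly `t` of the numbers `A_1, A_2, …` are nonzero. -/
def IsWeightCode (t : ℕ) {p n : ℕ} (C : Submodule (ZMod p) (Fin n → ZMod p)) : Prop :=
  (positiveWeights C).ncard = t

/-! Write N = `P ^ m`, r = √q and e = (q - 1)/N. For x ≠ 0 the element ζ = x^e is an N-th root of
unity. As 3 is a primitive root, the conjugates of ζ are the ζ^j with j prime to N, so Tr ζ is a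
Ramanujan sum: M(P - 1) if ζ = 1, -M if ζ has order P, and 0 otherwise, where M = N/P is prime to 3.
Let U_k be the group of k-th roots of unity. Then D is F^* without U_{Pe} ∖ U_e if P ≡ 1 mod 3, and
F^* without U_{Pe} if P ≡ -1 mod 3 (`mem_definingSet_iff`).

The primitive root also gives r ≡ -1 mod N (`dvd_three_pow_half_totient_add_one`). With r + 1 = NA
this yields e = (r - 1)A, so U_e and U_{Pe} are unions of cosets of the multiplicative group of 𝔽_r.
Averaging over that group determines how often Tr(ux) ≠ 0 on such a U: the count takes one value for
x ∈ U and another for x ∉ U, differing by 2r/3 (`three_mul_card_rootsOfUnity_trace_ne_zero`).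
Combining these counts by inclusion-exclusion leaves two weights on D. -/

open Finset in
theorem card_filter_pow_eq_one {F : Type*} [Field F] [Fintype F] [DecidableEq F] {k : ℕ}
    (hk : k ∣ Fintype.card F - 1) : #{x : F | x ^ k = 1} = k := by
  have hpos : 0 < Fintype.card F - 1 := Nat.sub_pos_of_lt Fintype.one_lt_card
  have hk0 : 0 < k := Nat.pos_of_dvd_of_pos hk hpos
  obtain ⟨g, hg⟩ := IsCyclic.exists_ofOrder_eq_natCard (α := Fˣ)
  rw [Nat.card_eq_fintype_card, Fintype.card_units] at hg
  obtain ⟨l, hl⟩ := hk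
  have h1 : IsPrimitiveRoot (g : F) (Fintype.card F - 1) := by
    rw [IsPrimitiveRoot.coe_units_iff, ← hg]; exact IsPrimitiveRoot.orderOf g
  have h2 := h1.pow hpos (hl.trans (mul_comm _ _))
  have h3 : ({x : F | x ^ k = 1} : Finset F) = Polynomial.nthRootsFinset k 1 := by
    ext x
    simp [Polynomial.mem_nthRootsFinset hk0]
  rw [h3, h2.card_nthRootsFinset]

open Finset in
theorem three_mul_card_filter_ne_zero {S : Type*} [AddGroup S] [Fintype S]
    (f : S →+ ZMod 3) (hf : ∃ t, f t ≠ 0) :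
    3 * #{t : S | f t ≠ 0} = 2 * Fintype.card S := by
  obtain ⟨t, ht⟩ := hf
  have hr : ∀ a : ZMod 3, a ∈ Set.range f := by
    intro a
    have : a = 0 ∨ a = f t ∨ a = f t + f t := by
      generalize f t = b at ht
      revert a b; decide
    rcases this with rfl | rfl | rfl
    · exact ⟨0, map_zero f⟩
    · exact ⟨t, rfl⟩
    · exact ⟨t + t, map_add f t t⟩
  have h1 := AddMonoidHom.card_fiber_eq_of_mem_range f (hr 1) (hr 0)
  have h2 := AddMonoidHom.card_fiber_eq_of_mem_range f (hr 2) (hr 0)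
  have h3 := Finset.card_eq_sum_card_fiberwise (f := f) (s := univ) (t := univ) (by simp)
  have h4 := Finset.card_filter_add_card_filter_not (s := (univ : Finset S)) (fun t => f t = 0)
  rw [show (univ : Finset (ZMod 3)) = {0, 1, 2} by decide,
    sum_insert (by decide), sum_insert (by decide), sum_singleton, h1, h2] at h3
  rw [card_univ] at h3 h4
  simp only [ne_eq]
  omega

/-! ### Semiprimitive weights: trace counts on groups of roots of unity -/

theorem trace_pow_three_pow {F : Type*} [Field F] [Finite F] [Algebra (ZMod 3) F] (h : ℕ) (x : F) :
    Algebra.trace (ZMod 3) F (x ^ 3 ^ h) = Algebra.trace (ZMod 3) F x := by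
  induction h with
  | zero => simp
  | succ k ih =>
    rw [pow_succ, pow_mul, ← ih]
    have := Algebra.trace_eq_of_algEquiv
      (FiniteField.frobeniusAlgEquivOfAlgebraic (ZMod 3) F) (x ^ 3 ^ k)
    simpa [FiniteField.coe_frobeniusAlgEquivOfAlgebraic] using this

-- With r = 3^h, the t in question form the multiplicative group of the subfield 𝔽_r. For t in 𝔽_r
-- one has 2 Tr(yt) = Tr((y + y^r)t), so this additive map on 𝔽_r vanishes identically exactly when
-- y^r = -y; otherwise it is onto 𝔽₃ and two thirds of 𝔽_r lie outside its kernel.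
open Finset in
theorem three_mul_card_trace_ne_zero {F : Type*} [Field F] [Fintype F] [DecidableEq F]
    [Algebra (ZMod 3) F] {h : ℕ} (hF : Fintype.card F = (3 ^ h) ^ 2) (y : F) :
    3 * #{t : F | t ^ (3 ^ h - 1) = 1 ∧ Algebra.trace (ZMod 3) F (y * t) ≠ 0}
      = if y ^ 3 ^ h = -y then 0 else 2 * 3 ^ h := by
  have : CharP F 3 := charP_of_injective_algebraMap (algebraMap (ZMod 3) F).injective 3
  set r := 3 ^ h with hr
  have hr0 : 0 < r := by positivity
  have h0 : h ≠ 0 := by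
    rintro rfl
    have : 1 < Fintype.card F := Fintype.one_lt_card
    simp [hF, r] at this
  have hr3 : 3 ≤ r := by simpa using Nat.pow_le_pow_right (n := 3) (by norm_num) (Nat.one_le_iff_ne_zero.2 h0)
  have hq : ∀ w : F, (w ^ r) ^ r = w := fun w => by
    rw [← pow_mul, ← pow_two, ← hF, FiniteField.pow_card]
  have hiff : ∀ t : F, t ^ r = t ↔ t = 0 ∨ t ^ (r - 1) = 1 := by
    intro t
    rcases eq_or_ne t 0 with rfl | ht
    · simp [hr0.ne']
    · rw [← Nat.sub_add_cancel hr0, pow_succ]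
      simp [ht]
  -- The subfield 𝔽_r, needed only as an additive group.
  let S : AddSubgroup F :=
    { carrier := {t | t ^ r = t}
      add_mem' := fun {a b} ha hb => by
        simp only [Set.mem_ofPred_eq] at *
        rw [hr, add_pow_char_pow, ← hr, ha, hb]
      zero_mem' := by simp [hr0.ne']
      neg_mem' := fun {a} ha => by
        simp only [Set.mem_ofPred_eq] at *
        rw [Odd.neg_pow (Odd.pow (by decide)), ha] }
  have hS : ∀ t, t ∈ S ↔ t ^ r = t := fun t => Iff.rfl
  have : DecidablePred (· ∈ S) := fun t => decidable_of_iff (t ^ r = t) (hS t).symm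
  have hcard : Fintype.card S = r := by
    have e1 : Fintype.card S = #{t : F | t ^ r = t} := 
      Fintype.card_of_subtype _ fun t => by simp [hS]
    have e2 : ({t : F | t ^ r = t} : Finset F) = insert 0 ({t : F | t ^ (r - 1) = 1} : Finset F) := by
      ext t; simp [hiff]
    rw [e1, e2, card_insert_of_notMem, card_filter_pow_eq_one]
    · omega
    · rw [hF]
      exact ⟨r + 1, by rw [mul_comm, ← Nat.sq_sub_sq, one_pow]⟩
    · simp [zero_pow (show r - 1 ≠ 0 by omega)]
  let f : S →+ ZMod 3 := ((Algebra.trace (ZMod 3) F).toAddMonoidHom.comp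
    (AddMonoidHom.mulLeft y)).comp S.subtype
  have hf : ∀ t : S, f t = Algebra.trace (ZMod 3) F (y * t) := fun t => rfl
  have hcf : #{t : F | t ^ (r - 1) = 1 ∧ Algebra.trace (ZMod 3) F (y * t) ≠ 0}
      = #{t : S | f t ≠ 0} := by
    rw [← card_map (Function.Embedding.subtype _)]
    congr 1
    ext t
    simp only [mem_filter, mem_univ, true_and, mem_map, hf, Function.Embedding.subtype_apply,
      Subtype.exists, hS, exists_and_left]
    constructor
    · rintro ⟨h1, h2⟩
      exact ⟨t, h2, (hiff t).2 (Or.inr h1), rfl⟩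
    · rintro ⟨t, h2, h1, rfl⟩
      refine ⟨((hiff t).1 h1).resolve_left ?_, h2⟩
      rintro rfl
      simp at h2
  have h2 : ∀ w : F, 2 * Algebra.trace (ZMod 3) F w = Algebra.trace (ZMod 3) F (w + w ^ r) := by
    intro w
    rw [map_add, hr, trace_pow_three_pow, two_mul]
  have h20 : ∀ a : ZMod 3, 2 * a = 0 ↔ a = 0 := by decide
  rw [hcf]
  split_ifs with hy
  · simp only [mul_eq_zero, OfNat.ofNat_ne_zero, false_or, card_eq_zero, filter_eq_empty_iff,
      mem_univ, true_implies, not_not]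
    rintro ⟨t, ht⟩
    rw [hS] at ht
    rw [hf, ← h20, h2, mul_pow, hy, ht]
    simp
  · rw [three_mul_card_filter_ne_zero f, hcard]
    obtain ⟨w, hw⟩ := Algebra.trace_surjective (ZMod 3) F 1
    have hs : y + y ^ r ≠ 0 := fun h => hy (eq_neg_of_add_eq_zero_right h)
    have hsS : (y + y ^ r) ^ r = y + y ^ r := by
      rw [hr, add_pow_char_pow, ← hr, hq, add_comm]
    have hwS : (w + w ^ r) ^ r = w + w ^ r := by
      rw [hr, add_pow_char_pow, ← hr, hq, add_comm]
    -- With Tr w = 1, this quotient t lies in 𝔽_r and satisfies 2 Tr(yt) = Tr(w + w^r) = 2 ≠ 0.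
    have ht : ((w + w ^ r) / (y + y ^ r)) ^ r = (w + w ^ r) / (y + y ^ r) := by
      rw [div_pow, hsS, hwS]
    refine ⟨⟨_, (hS _).2 ht⟩, ?_⟩
    rw [hf, ne_eq, ← h20, h2]
    simp only
    rw [mul_pow, ht, ← add_mul, mul_div_cancel₀ _ hs, ← h2, hw]
    decide

open Finset in
/-- The weight distribution of the trace code supported on the `e`-th roots of unity, in the
semiprimitive case. -/
theorem three_mul_card_rootsOfUnity_trace_ne_zero {F : Type*} [Field F] [Fintype F] [DecidableEq F]
    [Algebra (ZMod 3) F] {h e s : ℕ} (hF : Fintype.card F = (3 ^ h) ^ 2)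
    (he : e = (3 ^ h - 1) * s) (hs : Even s) (hes : e ∣ (3 ^ h) ^ 2 - 1) {x : F} (hx : x ≠ 0) :
    3 * #{u : F | u ^ e = 1 ∧ Algebra.trace (ZMod 3) F (u * x) ≠ 0}
      + (if x ^ e = 1 then 2 * 3 ^ h else 0) = 2 * 3 ^ h * s := by
  have key := fun y : F => three_mul_card_trace_ne_zero hF y
  set r := 3 ^ h with hr
  have hr0 : 0 < r := by positivity
  have h0 : h ≠ 0 := by
    rintro rfl
    have : 1 < Fintype.card F := Fintype.one_lt_card
    simp [hF, r] at this
  have hr3 : 3 ≤ r := by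
    simpa using Nat.pow_le_pow_right (n := 3) (by norm_num) (Nat.one_le_iff_ne_zero.2 h0)
  have hrq : r ^ 2 - 1 = (r - 1) * (r + 1) := by rw [mul_comm, ← Nat.sq_sub_sq, one_pow]
  have hodd : Odd r := Odd.pow (by decide)
  have hpos : 0 < r ^ 2 - 1 := by rw [hrq]; exact Nat.mul_pos (by omega) (by omega)
  have he0 : e ≠ 0 := (Nat.pos_of_dvd_of_pos hes hpos).ne'
  have hU : #{u : F | u ^ e = 1} = e := card_filter_pow_eq_one (hF ▸ hes)
  have hT : #{u : F | u ^ (r - 1) = 1} = r - 1 :=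
    card_filter_pow_eq_one (by rw [hF, hrq]; exact dvd_mul_right _ _)
  have hTU : ∀ t : F, t ^ (r - 1) = 1 → t ^ e = 1 := fun t ht => by rw [he, pow_mul, ht, one_pow]
  have hchar : (-1 : F) ≠ 1 := by
    have : CharP F 3 := charP_of_injective_algebraMap (algebraMap (ZMod 3) F).injective 3
    exact Ring.neg_one_ne_one_of_char_ne_two (by rw [ringChar.eq F 3]; norm_num)
  -- Since r + 1 is even, 2(r - 1) divides q - 1; these y are the 2(r - 1)-th roots of unity that
  -- are not (r - 1)-th ones.
  have hZ : #{y : F | y ^ (r - 1) = -1} = r - 1 := by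
    have h1 : #{y : F | y ^ (2 * (r - 1)) = 1} = 2 * (r - 1) := by
      apply card_filter_pow_eq_one
      rw [hF, hrq, mul_comm]
      exact mul_dvd_mul_left _ hodd.add_one.two_dvd
    have h2 : ({y : F | y ^ (2 * (r - 1)) = 1} : Finset F)
        = ({y : F | y ^ (r - 1) = 1} : Finset F) ∪ ({y : F | y ^ (r - 1) = -1} : Finset F) := by
      ext y
      simp [mul_comm 2, pow_mul]
    rw [h2, card_union_of_disjoint, hT] at h1
    · omega
    · rw [disjoint_filter]
      intro y _ h1 h2
      exact hchar (h2.symm.trans h1)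
  -- If (ux)^(r-1) = -1, then (ux)^e = (-1)^s = 1 because `s` is even, so u^e = 1 is equivalent to
  -- x^e = 1. This is where the count depends on x.
  have hZx : #{u : F | u ^ e = 1 ∧ (u * x) ^ r = -(u * x)} = if x ^ e = 1 then r - 1 else 0 := by
    have h1 : ∀ u : F, (u ^ e = 1 ∧ (u * x) ^ r = -(u * x))
        ↔ (x ^ e = 1 ∧ (u * x) ^ (r - 1) = -1) := by
      intro u
      rcases eq_or_ne u 0 with rfl | hu
      · simp [he0, zero_pow (show r - 1 ≠ 0 by omega)]
      · have h2 : (u * x) ^ r = -(u * x) ↔ (u * x) ^ (r - 1) = -1 := by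
          rw [← mul_left_inj' (a := (u * x) ^ (r - 1)) (mul_ne_zero hu hx),
            ← pow_succ, Nat.sub_add_cancel hr0, neg_one_mul]
        rw [h2]
        refine and_congr_left fun h3 => ?_
        have h4 : (u * x) ^ e = 1 := by rw [he, pow_mul, h3, hs.neg_one_pow]
        rw [mul_pow] at h4
        constructor
        · intro h5; simpa [h5] using h4
        · intro h5; simpa [h5] using h4
    simp only [h1]
    split_ifs with hxe
    · simp only [hxe, true_and]
      refine Eq.trans ?_ hZ
      refine card_bij (fun u _ => u * x) ?_ ?_ ?_
      · intro u hu; simpa using hu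
      · intro u _ v _ huv; exact mul_right_cancel₀ hx huv
      · intro y hy
        exact ⟨y / x, by simpa [div_mul_cancel₀ _ hx] using hy, div_mul_cancel₀ _ hx⟩
    · simp [hxe]
  -- Double counting of pairs (t, u). The inner count on the left is independent of t, since
  -- multiplication by t permutes the `e`-th roots of unity; on the right it is given by `key`.
  have hdouble : ∑ t ∈ ({t : F | t ^ (r - 1) = 1} : Finset F),
        #{u : F | u ^ e = 1 ∧ Algebra.trace (ZMod 3) F (u * x * t) ≠ 0}
      = ∑ u ∈ ({u : F | u ^ e = 1} : Finset F),
        #{t : F | t ^ (r - 1) = 1 ∧ Algebra.trace (ZMod 3) F (u * x * t) ≠ 0} := by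
    simp only [← filter_filter]
    exact sum_card_bipartiteAbove_eq_sum_card_bipartiteBelow
      (fun t u : F => Algebra.trace (ZMod 3) F (u * x * t) ≠ 0)
  have hleft : ∀ t ∈ ({t : F | t ^ (r - 1) = 1} : Finset F),
      #{u : F | u ^ e = 1 ∧ Algebra.trace (ZMod 3) F (u * x * t) ≠ 0}
        = #{u : F | u ^ e = 1 ∧ Algebra.trace (ZMod 3) F (u * x) ≠ 0} := by
    intro t ht
    simp only [mem_filter, mem_univ, true_and] at ht
    have ht0 : t ≠ 0 := by
      rintro rfl
      simp [zero_pow (show r - 1 ≠ 0 by omega)] at ht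
    refine card_bij (fun u _ => u * t) ?_ ?_ ?_
    · intro u hu
      simpa [mul_pow, hTU t ht, mul_right_comm] using hu
    · intro u _ v _ huv; exact mul_right_cancel₀ ht0 huv
    · intro y hy
      refine ⟨y / t, ?_, div_mul_cancel₀ _ ht0⟩
      have : y / t * x * t = y * x := by field_simp
      simpa [div_pow, hTU t ht, this] using hy
  rw [sum_congr rfl hleft, sum_const, hT, smul_eq_mul] at hdouble
  have h3 := congrArg (3 * ·) hdouble
  simp only [mul_sum, key] at h3
  rw [sum_ite, sum_const_zero, zero_add, sum_const, smul_eq_mul, filter_filter] at h3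
  have hsplit := card_filter_add_card_filter_not (s := ({u : F | u ^ e = 1} : Finset F))
    (fun u => (u * x) ^ r = -(u * x))
  rw [filter_filter, filter_filter, hZx, hU] at hsplit
  have hr1 : 0 < r - 1 := by omega
  apply Nat.eq_of_mul_eq_mul_left hr1
  set A := #{u : F | u ^ e = 1 ∧ ¬(u * x) ^ r = -(u * x)}
  set W := #{u : F | u ^ e = 1 ∧ Algebra.trace (ZMod 3) F (u * x) ≠ 0}
  have h4 : (r - 1) * (3 * W) = A * (2 * r) := by rw [← h3]; ring
  rw [mul_add, h4]
  split_ifs at hsplit ⊢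
  · calc A * (2 * r) + (r - 1) * (2 * r) = (r - 1 + A) * (2 * r) := by ring
      _ = _ := by rw [hsplit, he]; ring
  · calc A * (2 * r) + (r - 1) * 0 = (0 + A) * (2 * r) := by ring
      _ = _ := by rw [hsplit, he]; ring

/-! ### Consequences of 3 being a primitive root: traces of roots of unity -/

/-- The square of 3^(φ/2) is 1 modulo `P ^ m`. The factors 3^(φ/2) ± 1 differ by 2, so the odd prime
`P` divides only one of them and the whole power goes there; the order of 3 excludes the minus sign.
-/
theorem dvd_three_pow_half_totient_add_one {P m : ℕ} (hP : P.Prime) (hodd : Odd P) (hm : 1 ≤ m)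
    (hroot : orderOf (3 : ZMod (P ^ m)) = Nat.totient (P ^ m)) :
    Even (Nat.totient (P ^ m)) ∧ P ^ m ∣ 3 ^ (Nat.totient (P ^ m) / 2) + 1 := by
  have hP3 : 3 ≤ P := by
    have := hP.two_le
    obtain ⟨k, rfl⟩ := hodd
    omega
  have hN : 2 < P ^ m := lt_of_lt_of_le hP3 (Nat.le_self_pow (by omega) P)
  have hev := Nat.totient_even hN
  refine ⟨hev, ?_⟩
  have hpos : 0 < Nat.totient (P ^ m) := Nat.totient_pos.2 (by omega)
  set f := Nat.totient (P ^ m)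
  have hf : f / 2 * 2 = f := Nat.div_mul_cancel hev.two_dvd
  have hdvd : ∀ k, P ^ m ∣ 3 ^ k - 1 ↔ (3 : ZMod (P ^ m)) ^ k = 1 := by
    intro k
    rw [← ZMod.natCast_eq_zero_iff, Nat.cast_sub (Nat.one_le_pow _ _ (by norm_num)), sub_eq_zero]
    simp
  have h1 : P ^ m ∣ (3 ^ (f / 2) + 1) * (3 ^ (f / 2) - 1) := by
    rw [← Nat.sq_sub_sq, one_pow, ← pow_mul, hf, hdvd, ← hroot, pow_orderOf_eq_one]
  have h2 : ¬ P ^ m ∣ 3 ^ (f / 2) - 1 := by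
    rw [hdvd]
    exact pow_ne_one_of_lt_orderOf (by omega) (by rw [hroot]; omega)
  by_cases h3 : P ∣ 3 ^ (f / 2) + 1
  · have h4 : ¬ P ∣ 3 ^ (f / 2) - 1 := by
      intro h4
      have h5 := Nat.dvd_sub h3 h4
      have h6 : 1 ≤ 3 ^ (f / 2) := Nat.one_le_pow _ _ (by norm_num)
      have := Nat.le_of_dvd (by omega) h5
      omega
    exact (Nat.Coprime.pow_left m ((hP.coprime_iff_not_dvd).2 h4)).dvd_of_dvd_mul_right h1
  · exact absurd
      ((Nat.Coprime.pow_left m ((hP.coprime_iff_not_dvd).2 h3)).dvd_of_dvd_mul_left h1) h2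

open Finset in
theorem image_three_pow_mod {N : ℕ} (hN : 1 < N) (h3 : Nat.Coprime 3 N)
    (hroot : orderOf (3 : ZMod N) = Nat.totient N) :
    (range (Nat.totient N)).image (fun i => 3 ^ i % N) = {j ∈ range N | Nat.Coprime N j} := by
  have hinj : Set.InjOn (fun i => 3 ^ i % N) (range (Nat.totient N) : Set ℕ) := by
    intro i hi j hj hij
    have h1 : ((3 ^ i : ℕ) : ZMod N) = (3 ^ j : ℕ) := (ZMod.natCast_eq_natCast_iff' _ _ _).2 hij
    push_cast at h1
    refine pow_injOn_Iio_orderOf ?_ ?_ h1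
    · simpa [hroot] using hi
    · simpa [hroot] using hj
  apply eq_of_subset_of_card_le
  · intro j hj
    simp only [mem_image, mem_range] at hj
    obtain ⟨i, -, rfl⟩ := hj
    simp only [mem_filter, mem_range]
    refine ⟨Nat.mod_lt _ (by omega), ?_⟩
    rw [Nat.Coprime, Nat.gcd_comm, ← Nat.gcd_rec, Nat.gcd_comm]
    exact h3.pow_left i
  · rw [card_image_of_injOn hinj, card_range, ← Nat.totient_eq_card_coprime]

-- The Frobenius conjugates of ζ are the ζ^j with j prime to `P ^ (m + 1)`. The missing exponents
-- are the multiples of `P`, and adding them completes the geometric sum.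
open Finset in
theorem algebraMap_trace_add_sum {F : Type*} [Field F] [Finite F] [Algebra (ZMod 3) F] {P m : ℕ}
    (hP : P.Prime) (h3 : Nat.Coprime 3 P)
    (hroot : orderOf (3 : ZMod (P ^ (m + 1))) = Nat.totient (P ^ (m + 1)))
    (hF : Module.finrank (ZMod 3) F = Nat.totient (P ^ (m + 1))) {ζ : F}
    (hζ : ζ ^ P ^ (m + 1) = 1) :
    algebraMap (ZMod 3) F (Algebra.trace (ZMod 3) F ζ) + ∑ j ∈ range (P ^ m), (ζ ^ P) ^ j
      = ∑ j ∈ range (P ^ (m + 1)), ζ ^ j := by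
  have hN : 1 < P ^ (m + 1) := Nat.one_lt_pow (by omega) hP.one_lt
  have himg := image_three_pow_mod hN (h3.pow_right _) hroot
  have hmod : ∀ k, ζ ^ (k % P ^ (m + 1)) = ζ ^ k := fun k => (pow_eq_pow_mod k hζ).symm
  have h1 : algebraMap (ZMod 3) F (Algebra.trace (ZMod 3) F ζ)
      = ∑ j ∈ range (P ^ (m + 1)) with Nat.Coprime (P ^ (m + 1)) j, ζ ^ j := by
    rw [FiniteField.algebraMap_trace_eq_sum_pow, hF, ← himg, sum_image]
    · simp [hmod]
    · refine card_image_iff.1 ?_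
      rw [himg, card_range, ← Nat.totient_eq_card_coprime]
  have h2 : ∑ j ∈ range (P ^ (m + 1)) with ¬ Nat.Coprime (P ^ (m + 1)) j, ζ ^ j
      = ∑ j ∈ range (P ^ m), (ζ ^ P) ^ j := by
    symm
    refine sum_bij (fun j _ => P * j) ?_ ?_ ?_ ?_
    · intro j hj
      rw [mem_range] at hj
      simp only [mem_filter, mem_range, pow_succ', Nat.mul_lt_mul_left hP.pos]
      refine ⟨hj, fun h => ?_⟩
      exact hP.coprime_iff_not_dvd.1 (Nat.Coprime.coprime_mul_right h) (dvd_mul_right P j)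
    · intro i _ j _ hij
      exact Nat.eq_of_mul_eq_mul_left hP.pos hij
    · intro j hj
      simp only [mem_filter, mem_range] at hj
      have : P ∣ j := by
        by_contra h
        exact hj.2 (((hP.coprime_iff_not_dvd).2 h).pow_left _)
      obtain ⟨k, rfl⟩ := this
      refine ⟨k, ?_, rfl⟩
      rw [mem_range]
      exact lt_of_mul_lt_mul_left (by simpa [pow_succ'] using hj.1) (Nat.zero_le P)
    · intro j _
      rw [pow_mul]
  rw [h1, ← h2, sum_filter_add_sum_filter_not]

open Finset in
theorem sum_range_pow_eq_zero {F : Type*} [Field F] {ζ : F} {n : ℕ} (h : ζ ^ n = 1) (h1 : ζ ≠ 1) :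
    ∑ j ∈ range n, ζ ^ j = 0 := by
  rw [geom_sum_eq h1, h, sub_self, zero_div]

/-- The trace of a `P ^ (m + 1)`-th root of unity vanishes, except possibly when it is a `P`-th
root of unity. -/
theorem trace_eq_zero_iff_of_pow_eq_one {F : Type*} [Field F] [Finite F] [Algebra (ZMod 3) F]
    {P m : ℕ} (hP : P.Prime) (h3 : Nat.Coprime 3 P)
    (hroot : orderOf (3 : ZMod (P ^ (m + 1))) = Nat.totient (P ^ (m + 1)))
    (hF : Module.finrank (ZMod 3) F = Nat.totient (P ^ (m + 1))) {ζ : F}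
    (hζ : ζ ^ P ^ (m + 1) = 1) :
    Algebra.trace (ZMod 3) F ζ = 0 ↔ (ζ ^ P = 1 → ζ = 1 ∧ 3 ∣ P - 1) := by
  have hsum := algebraMap_trace_add_sum hP h3 hroot hF hζ
  have : CharP F 3 := charP_of_injective_algebraMap (algebraMap (ZMod 3) F).injective 3
  have hM : ((P ^ m : ℕ) : F) ≠ 0 := by
    rw [ne_eq, CharP.cast_eq_zero_iff F 3, ← Nat.Prime.coprime_iff_not_dvd Nat.prime_three]
    exact h3.pow_right m
  rw [← map_eq_zero (algebraMap (ZMod 3) F)]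
  -- The three values of the trace: `P ^ m` (P - 1) at ζ = 1, -`P ^ m` at order `P`, and 0
  -- elsewhere.
  by_cases h1 : ζ = 1
  · subst h1
    have h4 : ((P - 1 : ℕ) : F) = 0 ↔ 3 ∣ P - 1 := CharP.cast_eq_zero_iff F 3 _
    rw [Nat.cast_sub hP.one_le] at h4
    simp only [one_pow, Finset.sum_const, Finset.card_range, nsmul_eq_mul, mul_one] at hsum
    rw [eq_sub_of_add_eq hsum, pow_succ, Nat.cast_mul]
    have h5 : ((P ^ m : ℕ) : F) * P - (P ^ m : ℕ) = (P ^ m : ℕ) * ((P : F) - (1 : ℕ)) := by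
      push_cast; ring
    rw [h5, mul_eq_zero, or_iff_right hM, h4]
    simp
  · rw [sum_range_pow_eq_zero hζ h1] at hsum
    by_cases h2 : ζ ^ P = 1
    · simp only [h2, one_pow, Finset.sum_const, Finset.card_range, nsmul_eq_mul, mul_one] at hsum
      rw [eq_neg_of_add_eq_zero_left hsum, neg_eq_zero]
      simpa only [h1, h2, false_and, imp_false, not_true, iff_false] using hM
    · rw [sum_range_pow_eq_zero (by rw [← pow_mul, ← pow_succ', hζ]) h2, add_zero] at hsum
      simp [hsum, h2]

/-! ### Weight distribution of a trace code -/

open Finset in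
theorem card_trace_ne_zero {F : Type*} [Field F] [Fintype F] [DecidableEq F]
    [Algebra (ZMod 3) F] {h : ℕ} (hF : Fintype.card F = (3 ^ h) ^ 2) {x : F} (hx : x ≠ 0) :
    3 * #{u : F | Algebra.trace (ZMod 3) F (u * x) ≠ 0} = 2 * (3 ^ h) ^ 2 := by
  have h1 := three_mul_card_filter_ne_zero
    ((Algebra.trace (ZMod 3) F).toAddMonoidHom.comp (AddMonoidHom.mulRight x)) ?_
  · rwa [hF] at h1
  · obtain ⟨w, hw⟩ := Algebra.trace_surjective (ZMod 3) F 1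
    exact ⟨w / x, by simp [div_mul_cancel₀ _ hx, hw]⟩

open Finset in
/-- A trace code for which the weight of the word of `x ≠ 0` is `a` or `b`, according to
whether `p x` holds, is a two-weight code. -/
theorem traceCode_two_weight {F : Type*} [Field F] [Fintype F] [DecidableEq F]
    [Algebra (ZMod 3) F] {n : ℕ} (d : Fin n → F) (p : F → Prop) [DecidablePred p] {a b : ℕ}
    (ha : 0 < a) (hb : 0 < b) (hab : a ≠ b)
    (hw : ∀ x, x ≠ 0 →
      #{i | Algebra.trace (ZMod 3) F (d i * x) ≠ 0} = if p x then a else b)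
    (hp : 0 < #{x : F | x ≠ 0 ∧ p x}) (hp' : 0 < #{x : F | x ≠ 0 ∧ ¬ p x}) :
    Module.finrank (ZMod 3) (traceCode 3 d) = Module.finrank (ZMod 3) F ∧
      IsWeightCode 2 (traceCode 3 d) ∧ positiveWeights (traceCode 3 d) = {a, b} ∧
      weightCount (traceCode 3 d) a = #{x : F | x ≠ 0 ∧ p x} ∧
      weightCount (traceCode 3 d) b = #{x : F | x ≠ 0 ∧ ¬ p x} := by
  set φ : F →ₗ[ZMod 3] (Fin n → ZMod 3) := LinearMap.pi fun i =>
    (Algebra.trace (ZMod 3) F).comp (LinearMap.mulLeft (ZMod 3) (d i)) with hφ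
  have hcode : traceCode 3 d = LinearMap.range φ := rfl
  have hnorm : ∀ x, x ≠ 0 → hammingNorm (φ x) = if p x then a else b := fun x hx => hw x hx
  -- Both weights are positive, so no x ≠ 0 gives the zero word. This yields the dimension and turns
  -- counts of codewords into counts of x.
  have hinj : Function.Injective φ := by
    rw [← LinearMap.ker_eq_bot, LinearMap.ker_eq_bot']
    intro x hx
    by_contra h0
    have := hnorm x h0
    rw [hx, hammingNorm_zero] at this
    split_ifs at this <;> omega
  have hcount : ∀ i, weightCount (traceCode 3 d) i = #{x : F | hammingNorm (φ x) = i} := by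
    intro i
    have : {c : Fin n → ZMod 3 | c ∈ traceCode 3 d ∧ hammingNorm c = i}
        = φ '' ({x : F | hammingNorm (φ x) = i} : Finset F) := by
      ext c
      simp only [hcode, LinearMap.mem_range, Set.mem_ofPred_eq, Set.mem_image, coe_filter,
        mem_univ, true_and]
      constructor
      · rintro ⟨⟨x, rfl⟩, h⟩
        exact ⟨x, h, rfl⟩
      · rintro ⟨x, h, rfl⟩
        exact ⟨⟨x, rfl⟩, h⟩
    rw [weightCount, this, Set.ncard_image_of_injective _ hinj, Set.ncard_coe_finset]
  have hcount' : ∀ i, 0 < i → weightCount (traceCode 3 d) i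
      = #{x : F | x ≠ 0 ∧ (if p x then a else b) = i} := by
    intro i hi
    rw [hcount]
    congr 1
    ext x
    simp only [mem_filter, mem_univ, true_and]
    rcases eq_or_ne x 0 with rfl | hx
    · simp [hi.ne]
    · simp [hx, hnorm x hx]
  have hca : weightCount (traceCode 3 d) a = #{x : F | x ≠ 0 ∧ p x} := by
    rw [hcount' a ha]
    congr 1
    ext x
    by_cases h : p x <;> simp [h, hab.symm]
  have hcb : weightCount (traceCode 3 d) b = #{x : F | x ≠ 0 ∧ ¬ p x} := by
    rw [hcount' b hb]
    congr 1
    ext x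
    by_cases h : p x <;> simp [h, hab]
  have hpw : positiveWeights (traceCode 3 d) = {a, b} := by
    ext i
    simp only [positiveWeights, Set.mem_ofPred_eq, Set.mem_insert_iff, Set.mem_singleton_iff]
    constructor
    · rintro ⟨hi, h⟩
      rw [hcount' i hi, card_ne_zero] at h
      obtain ⟨x, hx⟩ := h
      simp only [mem_filter, mem_univ, true_and] at hx
      split_ifs at hx
      · exact Or.inl hx.2.symm
      · exact Or.inr hx.2.symm
    · rintro (rfl | rfl)
      · exact ⟨ha, by omega⟩
      · exact ⟨hb, by omega⟩
  refine ⟨LinearMap.finrank_range_of_inj hinj, ?_, hpw, hca, hcb⟩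
  rw [IsWeightCode, hpw, Set.ncard_pair hab]

open Finset in
theorem card_filter_enumeration {ι F : Type*} [Fintype ι] [Fintype F] [DecidableEq F]
    {d : ι → F} (hinj : Function.Injective d) (p s : F → Prop) [DecidablePred p] [DecidablePred s]
    (hd : ∀ x, x ∈ Set.range d ↔ s x) : #{i | p (d i)} = #{x : F | s x ∧ p x} := by
  rw [← card_image_of_injective _ hinj]
  congr 1
  ext x
  simp only [mem_image, mem_filter, mem_univ, true_and, ← hd, Set.mem_range]
  constructor
  · rintro ⟨i, h, rfl⟩
    exact ⟨⟨i, rfl⟩, h⟩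
  · rintro ⟨⟨i, rfl⟩, h⟩
    exact ⟨i, h, rfl⟩

/-! ### The defining set as a complement, and the two resulting codes -/

/-- The defining set in terms of `e`-th roots of unity, `e = (q - 1) / N`. -/
theorem mem_definingSet_iff {F : Type*} [Field F] [Fintype F] [Algebra (ZMod 3) F]
    {P m : ℕ} (hP : P.Prime) (h3 : Nat.Coprime 3 P)
    (hroot : orderOf (3 : ZMod (P ^ (m + 1))) = Nat.totient (P ^ (m + 1)))
    (hF : Module.finrank (ZMod 3) F = Nat.totient (P ^ (m + 1))) {e : ℕ}
    (he : Fintype.card F - 1 = P ^ (m + 1) * e) (x : F) :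
    x ∈ definingSet F (P ^ (m + 1)) ↔
      x ≠ 0 ∧ (x ^ (P * e) = 1 → x ^ e = 1 ∧ 3 ∣ P - 1) := by
  have hdiv : (Nat.card F - 1) / P ^ (m + 1) = e := by
    rw [Nat.card_eq_fintype_card, he, Nat.mul_div_cancel_left _ (pow_pos hP.pos _)]
  rw [definingSet, Set.mem_ofPred_eq, hdiv]
  refine and_congr_right fun hx => ?_
  rw [trace_eq_zero_iff_of_pow_eq_one hP h3 hroot hF, ← pow_mul, mul_comm e P]
  rw [← pow_mul, mul_comm, ← he, FiniteField.pow_card_sub_one_eq_one x hx]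

open Finset in
/-- The weights attached to the nested groups of `e`-th and `P * e`-th roots of unity, where
`e = (r - 1) * A`, `r = 3 ^ (k + 1)`. -/
theorem semiprimitive_weights {F : Type*} [Field F] [Fintype F] [DecidableEq F]
    [Algebra (ZMod 3) F] {k N P M A : ℕ} (hF : Fintype.card F = (3 ^ (k + 1)) ^ 2)
    (hA : 3 ^ (k + 1) + 1 = N * A) (hN : Odd N) (hNM : N = P * M) :
    let e := (3 ^ (k + 1) - 1) * A
    Even A ∧ Fintype.card F - 1 = N * e ∧ #{x : F | x ^ e = 1} = e ∧ #{x : F | x ^ (P * e) = 1} = P * e ∧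
    ∀ x : F, x ≠ 0 →
      #{u : F | u ^ e = 1 ∧ Algebra.trace (ZMod 3) F (u * x) ≠ 0}
        + (if x ^ e = 1 then 2 * 3 ^ k else 0) = 2 * 3 ^ k * A ∧
      #{u : F | u ^ (P * e) = 1 ∧ Algebra.trace (ZMod 3) F (u * x) ≠ 0}
        + (if x ^ (P * e) = 1 then 2 * 3 ^ k else 0) = 2 * 3 ^ k * (P * A) ∧
      #{u : F | Algebra.trace (ZMod 3) F (u * x) ≠ 0} = 2 * 3 ^ k * 3 ^ (k + 1) := by
  intro e
  have h1 : (3 ^ (k + 1)) ^ 2 - 1 = N * e := by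
    rw [← one_pow 2, Nat.sq_sub_sq, one_pow, hA]
    ring
  have h2 : e ∣ (3 ^ (k + 1)) ^ 2 - 1 := ⟨N, by rw [h1, mul_comm]⟩
  have h3 : P * e ∣ (3 ^ (k + 1)) ^ 2 - 1 := ⟨M, by rw [h1, hNM]; ring⟩
  -- `N * A` = r + 1 is even while `N` is odd; this provides the parity needed in the semiprimitive
  -- count.
  have hev : Even A := by
    have : Even (N * A) := by
      rw [← hA]
      exact (Odd.pow (by decide)).add_one
    exact (Nat.even_mul.1 this).resolve_left (Nat.not_even_iff_odd.2 hN)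
  refine ⟨hev, by rw [hF, h1], card_filter_pow_eq_one (hF ▸ h2), card_filter_pow_eq_one (hF ▸ h3), ?_⟩
  intro x hx
  have hr : 3 ^ (k + 1) = 3 * 3 ^ k := pow_succ' 3 k
  have w1 := three_mul_card_rootsOfUnity_trace_ne_zero hF (e := e) rfl hev h2 hx
  have w2 := three_mul_card_rootsOfUnity_trace_ne_zero hF (e := P * e) (s := P * A) (by ring)
    (hev.mul_left P) h3 hx
  have w3 := card_trace_ne_zero hF hx
  refine ⟨?_, ?_, ?_⟩
  · apply Nat.eq_of_mul_eq_mul_left (show 0 < 3 by norm_num)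
    rw [mul_add]
    convert w1 using 1
    · split_ifs <;> simp [hr]; ring
    · rw [hr]; ring
  · apply Nat.eq_of_mul_eq_mul_left (show 0 < 3 by norm_num)
    rw [mul_add]
    convert w2 using 1
    · split_ifs <;> simp [hr]; ring
    · rw [hr]; ring
  · apply Nat.eq_of_mul_eq_mul_left (show 0 < 3 by norm_num)
    rw [w3, hr]; ring

open Finset in
theorem card_filter_imp_add {F : Type*} [Fintype F] (a b t : F → Prop) [DecidablePred a]
    [DecidablePred b] [DecidablePred t] (hab : ∀ x, a x → b x) :
    #{x : F | (b x → a x) ∧ t x} + #{x : F | b x ∧ t x}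
      = #{x : F | t x} + #{x : F | a x ∧ t x} := by
  simp only [card_filter, ← sum_add_distrib]
  refine sum_congr rfl fun x _ => ?_
  have := hab x
  by_cases h1 : a x <;> by_cases h2 : b x <;> by_cases h3 : t x <;> simp_all

open Finset in
theorem card_filter_ne_zero {F : Type*} [Field F] [Fintype F] [DecidableEq F] :
    #{x : F | x ≠ 0} = Fintype.card F - 1 := by
  rw [filter_ne', card_erase_of_mem (mem_univ 0), card_univ]

open Finset in
theorem card_filter_pow_and_ne_zero {F : Type*} [Field F] [Fintype F] [DecidableEq F] {j : ℕ}
    (hj : j ≠ 0) : #{x : F | x ^ j = 1 ∧ x ≠ 0} = #{x : F | x ^ j = 1} := by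
  congr 1
  ext x
  simp only [mem_filter, mem_univ, true_and, and_iff_left_iff_imp]
  rintro hx rfl
  simp [hj] at hx

open Finset in
/-- If the defining set is the complement in `F^*` of the `P * e`-th roots of unity that are not
`e`-th roots of unity, the code has two weights. -/
theorem two_weight_of_compl_diff {F : Type*} [Field F] [Fintype F] [DecidableEq F]
    [Algebra (ZMod 3) F] {n : ℕ} {d : Fin n → F} (hinj : Function.Injective d) {P M A R e : ℕ}
    (hR : 0 < R) (hP : 2 ≤ P) (hM : 0 < M) (hA2 : 2 ≤ A) (he : 0 < e)
    (hA : 3 * R + 1 = P * M * A) (hqe : Fintype.card F - 1 = P * M * e)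
    (hce : #{x : F | x ^ e = 1} = e) (hcPe : #{x : F | x ^ (P * e) = 1} = P * e)
    (hw : ∀ x : F, x ≠ 0 →
      #{u : F | u ^ e = 1 ∧ Algebra.trace (ZMod 3) F (u * x) ≠ 0}
          + (if x ^ e = 1 then 2 * R else 0) = 2 * R * A ∧
        #{u : F | u ^ (P * e) = 1 ∧ Algebra.trace (ZMod 3) F (u * x) ≠ 0}
          + (if x ^ (P * e) = 1 then 2 * R else 0) = 2 * R * (P * A) ∧
        #{u : F | Algebra.trace (ZMod 3) F (u * x) ≠ 0} = 2 * R * (3 * R))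
    (hD : ∀ x, x ∈ Set.range d ↔ x ≠ 0 ∧ (x ^ (P * e) = 1 → x ^ e = 1)) :
    n + P * e = P * M * e + e ∧
      Module.finrank (ZMod 3) (traceCode 3 d) = Module.finrank (ZMod 3) F ∧
      IsWeightCode 2 (traceCode 3 d) ∧
      ∃ a, a + 2 * R * (P * A) = 2 * R * (3 * R) + 2 * R * A ∧
        positiveWeights (traceCode 3 d) = {a, a + 2 * R} ∧
        weightCount (traceCode 3 d) a = n ∧
        weightCount (traceCode 3 d) (a + 2 * R) + e = P * e := by
  have hPe : 0 < P * e := Nat.mul_pos (by omega) he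
  have heP : ∀ x : F, x ^ e = 1 → x ^ (P * e) = 1 := fun x hx => by
    rw [mul_comm, pow_mul, hx, one_pow]
  have hn : n = #{x : F | x ≠ 0 ∧ (x ^ (P * e) = 1 → x ^ e = 1)} := by
    simpa using card_filter_enumeration hinj (fun _ => True) _ hD
  have hn2 := card_filter_imp_add (fun x : F => x ^ e = 1) (fun x => x ^ (P * e) = 1)
    (fun x => x ≠ 0) heP
  rw [card_filter_pow_and_ne_zero hPe.ne', card_filter_pow_and_ne_zero he.ne', hce, hcPe,
    card_filter_ne_zero, hqe] at hn2
  simp only [and_comm (b := _ ≠ _)] at hn2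
  rw [← hn] at hn2
  have hnot : #{x : F | x ≠ 0 ∧ ¬ (x ^ (P * e) = 1 → x ^ e = 1)} + n = P * M * e := by
    rw [hn, ← hqe, ← card_filter_ne_zero (F := F), ← card_filter_add_card_filter_not
      (s := ({x : F | x ≠ 0} : Finset F)) (fun x => x ^ (P * e) = 1 → x ^ e = 1),
      filter_filter, filter_filter, add_comm]
  have hPA : P * A ≤ 3 * R + 1 := by
    rw [hA]
    exact Nat.mul_le_mul_right _ (Nat.le_mul_of_pos_right _ hM)
  have hn0 : 0 < n := by
    have : P * e ≤ P * M * e := Nat.mul_le_mul_right _ (Nat.le_mul_of_pos_right _ hM)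
    omega
  have hlt : e < P * e := by nlinarith
  -- Weight on F^*, minus that on the `P * e`-th roots, plus that on the `e`-th roots, for x in D:
  -- there the two corrections 2R cancel or are both absent. Otherwise only the one for `P * e`
  -- remains, giving a + 2R. When `M = 1`, `P * A` equals 3R + 1, and `2 ≤ A` keeps `a` positive.
  obtain ⟨a, ha⟩ : ∃ a, a = 2 * R * (3 * R + A - P * A) := ⟨_, rfl⟩
  have ha0 : 0 < a := by
    rw [ha]
    exact Nat.mul_pos (by omega) (by omega)
  have ha' : a + 2 * R * (P * A) = 2 * R * (3 * R) + 2 * R * A := by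
    rw [ha, ← mul_add, ← mul_add, Nat.sub_add_cancel (by omega)]
  obtain ⟨c1, c2, c3, c4, c5⟩ := traceCode_two_weight d
    (fun x => x ^ (P * e) = 1 → x ^ e = 1) (a := a) (b := a + 2 * R) ha0 (by omega) (by omega)
    (fun x hx => by
      rw [card_filter_enumeration hinj (fun y => Algebra.trace (ZMod 3) F (y * x) ≠ 0) _ hD]
      obtain ⟨w1, w2, w3⟩ := hw x hx
      have w4 := card_filter_imp_add (fun x : F => x ^ e = 1) (fun x => x ^ (P * e) = 1)
        (fun y => Algebra.trace (ZMod 3) F (y * x) ≠ 0) heP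
      have w5 : #{y : F | (y ≠ 0 ∧ (y ^ (P * e) = 1 → y ^ e = 1)) ∧
            Algebra.trace (ZMod 3) F (y * x) ≠ 0}
          = #{y : F | (y ^ (P * e) = 1 → y ^ e = 1) ∧
            Algebra.trace (ZMod 3) F (y * x) ≠ 0} := by
        congr 1
        ext y
        simp only [mem_filter, mem_univ, true_and]
        refine ⟨fun h => ⟨h.1.2, h.2⟩, fun h => ⟨⟨?_, h.1⟩, h.2⟩⟩
        rintro rfl
        simp at h
      rw [w5]
      by_cases hxe : x ^ e = 1
      · rw [if_pos hxe] at w1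
        rw [if_pos (heP x hxe)] at w2
        rw [if_pos fun _ => hxe]
        omega
      · rw [if_neg hxe] at w1
        by_cases hxP : x ^ (P * e) = 1
        · rw [if_pos hxP] at w2
          rw [if_neg fun h => hxe (h hxP)]
          omega
        · rw [if_neg hxP] at w2
          rw [if_pos fun h => absurd h hxP]
          omega) (by omega) (by omega)
  exact ⟨hn2, c1, c2, a, ha', c3, c4.trans hn.symm, by omega⟩

open Finset in
/-- If the defining set is the complement in `F^*` of the `P * e`-th roots of unity, the code has
two weights. -/
theorem two_weight_of_compl {F : Type*} [Field F] [Fintype F] [DecidableEq F]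
    [Algebra (ZMod 3) F] {n : ℕ} {d : Fin n → F} (hinj : Function.Injective d) {P M A R e : ℕ}
    (hR : 0 < R) (hP : 0 < P) (hM : 3 ≤ M) (hA0 : 0 < A) (he : 0 < e)
    (hA : 3 * R + 1 = P * M * A) (hqe : Fintype.card F - 1 = P * M * e)
    (hcPe : #{x : F | x ^ (P * e) = 1} = P * e)
    (hw : ∀ x : F, x ≠ 0 →
      #{u : F | u ^ (P * e) = 1 ∧ Algebra.trace (ZMod 3) F (u * x) ≠ 0}
          + (if x ^ (P * e) = 1 then 2 * R else 0) = 2 * R * (P * A) ∧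
        #{u : F | Algebra.trace (ZMod 3) F (u * x) ≠ 0} = 2 * R * (3 * R))
    (hD : ∀ x, x ∈ Set.range d ↔ x ≠ 0 ∧ ¬ x ^ (P * e) = 1) :
    n + P * e = P * M * e ∧
      Module.finrank (ZMod 3) (traceCode 3 d) = Module.finrank (ZMod 3) F ∧
      IsWeightCode 2 (traceCode 3 d) ∧
      ∃ b, b + 2 * R * (P * A) = 2 * R * (3 * R) ∧
        positiveWeights (traceCode 3 d) = {b + 2 * R, b} ∧
        weightCount (traceCode 3 d) (b + 2 * R) = P * e ∧
        weightCount (traceCode 3 d) b = n := by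
  have hPe : 0 < P * e := Nat.mul_pos hP he
  have hn : n = #{x : F | x ≠ 0 ∧ ¬ x ^ (P * e) = 1} := by
    simpa using card_filter_enumeration hinj (fun _ => True) _ hD
  have hP1 : #{x : F | x ≠ 0 ∧ x ^ (P * e) = 1} = P * e := by
    simp only [and_comm (a := _ ≠ _)]
    rw [card_filter_pow_and_ne_zero hPe.ne', hcPe]
  have hn2 : n + P * e = P * M * e := by
    rw [← hqe, ← card_filter_ne_zero (F := F), ← card_filter_add_card_filter_not
      (s := ({x : F | x ≠ 0} : Finset F)) (fun x => x ^ (P * e) = 1),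
      filter_filter, filter_filter, hP1, ← hn, add_comm]
  have hn0 : 0 < n := by
    have : P * e * 3 ≤ P * M * e := by
      rw [mul_right_comm]; exact Nat.mul_le_mul_right _ (Nat.mul_le_mul_left _ hM)
    omega
  have hPA3 : P * A * 3 ≤ 3 * R + 1 := by
    rw [hA, mul_right_comm]
    exact Nat.mul_le_mul_right _ (Nat.mul_le_mul_left _ hM)
  -- Weight on F^* minus that on the `P * e`-th roots, for x outside that group; inside it, the
  -- correction adds 2R. Positivity comes from `hPA3`, that is, from `3 ≤ M`.
  obtain ⟨b, hb⟩ : ∃ b, b = 2 * R * (3 * R - P * A) := ⟨_, rfl⟩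
  have hb0 : 0 < b := by
    rw [hb]
    have : 0 < P * A := Nat.mul_pos hP hA0
    exact Nat.mul_pos (by omega) (by omega)
  have hb' : b + 2 * R * (P * A) = 2 * R * (3 * R) := by
    rw [hb, ← mul_add, Nat.sub_add_cancel (by omega)]
  obtain ⟨c1, c2, c3, c4, c5⟩ := traceCode_two_weight d
    (fun x => x ^ (P * e) = 1) (a := b + 2 * R) (b := b) (by omega) hb0 (by omega)
    (fun x hx => by
      rw [card_filter_enumeration hinj (fun y => Algebra.trace (ZMod 3) F (y * x) ≠ 0) _ hD]
      obtain ⟨w2, w3⟩ := hw x hx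
      have w4 := card_filter_add_card_filter_not
        (s := ({y : F | Algebra.trace (ZMod 3) F (y * x) ≠ 0} : Finset F))
        (fun y => y ^ (P * e) = 1)
      rw [filter_filter, filter_filter] at w4
      simp only [and_comm (b := _ ^ _ = _)] at w4
      have w5 : #{y : F | (y ≠ 0 ∧ ¬ y ^ (P * e) = 1) ∧ Algebra.trace (ZMod 3) F (y * x) ≠ 0}
          = #{y : F | Algebra.trace (ZMod 3) F (y * x) ≠ 0 ∧ ¬ y ^ (P * e) = 1} := by
        congr 1
        ext y
        simp only [mem_filter, mem_univ, true_and]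
        refine ⟨fun h => ⟨h.2, h.1.2⟩, fun h => ⟨⟨?_, h.2⟩, h.1⟩⟩
        rintro rfl
        simp at h
      rw [w5]
      split_ifs at w2 ⊢ <;> omega) (by omega) (by omega)
  exact ⟨hn2, c1, c2, b, hb', c3, c4.trans hP1, c5.trans hn.symm⟩

/-! ### The main theorem -/

theorem theorem4p1 (P m q : ℕ) (hP : P.Prime) (hodd : Odd P) (hm : 1 ≤ m)
    -- 3 is a primitive root modulo P ^ m
    (hroot : orderOf (3 : ZMod (P ^ m)) = Nat.totient (P ^ m))
    (hq : q = 3 ^ Nat.totient (P ^ m))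
    (F : Type*) [Field F] [Algebra (ZMod 3) F] (hF : Nat.card F = q)
    -- d₁, …, dₙ is an enumeration of the defining set without repetition
    (n : ℕ) (d : Fin n → F) (hinj : Function.Injective d)
    (hd : Set.range d = definingSet F (P ^ m)) :
    ((P : ℤ) ≡ 1 [ZMOD 3] →
      (n : ℝ) = ((q : ℝ) - 1) * ((P : ℝ) ^ m - P + 1) / (P : ℝ) ^ m ∧
      Module.finrank (ZMod 3) (traceCode 3 d) = (P - 1) * P ^ (m - 1) ∧
      IsWeightCode 2 (traceCode 3 d) ∧
      ∃ w₁ w₂ : ℕ,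
        (w₁ : ℝ) = 2 * ((P : ℝ) ^ m - P + 1) * q / (3 * (P : ℝ) ^ m)
          - 2 * ((P : ℝ) - 1) * Real.sqrt q / (3 * (P : ℝ) ^ m) ∧
        (w₂ : ℝ) = 2 * ((P : ℝ) ^ m - P + 1) * q / (3 * (P : ℝ) ^ m)
          + 2 * ((P : ℝ) ^ m - P + 1) * Real.sqrt q / (3 * (P : ℝ) ^ m) ∧
        positiveWeights (traceCode 3 d) = {w₁, w₂} ∧
        (weightCount (traceCode 3 d) w₁ : ℝ)
          = ((P : ℝ) ^ m - P + 1) * ((q : ℝ) - 1) / (P : ℝ) ^ m ∧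
        (weightCount (traceCode 3 d) w₂ : ℝ)
          = ((P : ℝ) - 1) * ((q : ℝ) - 1) / (P : ℝ) ^ m) ∧
    ((P : ℤ) ≡ -1 [ZMOD 3] → 2 ≤ m →
      (n : ℝ) = ((q : ℝ) - 1) * ((P : ℝ) ^ (m - 1) - 1) / (P : ℝ) ^ (m - 1) ∧
      Module.finrank (ZMod 3) (traceCode 3 d) = (P - 1) * P ^ (m - 1) ∧
      IsWeightCode 2 (traceCode 3 d) ∧
      ∃ w₁ w₂ : ℕ,
        (w₁ : ℝ) = 2 * ((P : ℝ) ^ (m - 1) - 1) * q / (3 * (P : ℝ) ^ (m - 1))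
          + 2 * ((P : ℝ) ^ (m - 1) - 1) * Real.sqrt q / (3 * (P : ℝ) ^ (m - 1)) ∧
        (w₂ : ℝ) = 2 * ((P : ℝ) ^ (m - 1) - 1) * q / (3 * (P : ℝ) ^ (m - 1))
          - 2 * Real.sqrt q / (3 * (P : ℝ) ^ (m - 1)) ∧
        positiveWeights (traceCode 3 d) = {w₁, w₂} ∧
        (weightCount (traceCode 3 d) w₁ : ℝ) = ((q : ℝ) - 1) / (P : ℝ) ^ (m - 1) ∧
        (weightCount (traceCode 3 d) w₂ : ℝ)
          = ((P : ℝ) ^ (m - 1) - 1) * ((q : ℝ) - 1) / (P : ℝ) ^ (m - 1)) := by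
  classical
  -- From here `m` is one less than in the statement, so that `M = P ^ m` is N/P.
  obtain ⟨m, rfl⟩ : ∃ k, m = k + 1 := ⟨m - 1, by omega⟩
  rw [Nat.add_sub_cancel]
  have : Finite F := Nat.finite_of_card_ne_zero (by rw [hF, hq]; positivity)
  have := Fintype.ofFinite F
  obtain ⟨hev, A, hA⟩ := dvd_three_pow_half_totient_add_one hP hodd hm hroot
  obtain ⟨h, hh⟩ : ∃ h, Nat.totient (P ^ (m + 1)) = 2 * h := hev.two_dvd
  have hrank : Module.finrank (ZMod 3) F = Nat.totient (P ^ (m + 1)) := by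
    have h1 := Module.card_eq_pow_finrank (K := ZMod 3) (V := F)
    rw [← Nat.card_eq_fintype_card, hF, hq, Fintype.card_eq_nat_card, Nat.card_zmod] at h1
    exact (Nat.pow_right_injective (by norm_num : 2 ≤ 3) h1).symm
  have hrank' : Module.finrank (ZMod 3) F = (P - 1) * P ^ m := by
    rw [hrank, Nat.totient_prime_pow_succ hP, mul_comm]
  have hh0 : 0 < h := by
    have := Nat.totient_pos.2 (pow_pos hP.pos (m + 1))
    omega
  obtain ⟨k, rfl⟩ : ∃ k, h = k + 1 := ⟨h - 1, by omega⟩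
  rw [hh, Nat.mul_div_cancel_left _ two_pos] at hA
  have hcard : Fintype.card F = (3 ^ (k + 1)) ^ 2 := by
    rw [← Nat.card_eq_fintype_card, hF, hq, hh, mul_comm, pow_mul]
  have hP3 : 3 ≤ P := by
    have := hP.two_le
    obtain ⟨k, rfl⟩ := hodd
    omega
  obtain ⟨hAev, hqe, hce, hcPe, hw⟩ := semiprimitive_weights hcard hA hodd.pow (pow_succ' P m)
  set e := (3 ^ (k + 1) - 1) * A with he
  rw [pow_succ' 3 k] at hA he hcard hw
  set R := 3 ^ k with hR
  have hR0 : 0 < R := by positivity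
  set M := P ^ m with hM
  have hM0 : 0 < M := pow_pos hP.pos m
  have hA0 : 0 < A := by
    rcases Nat.eq_zero_or_pos A with rfl | h
    · simp at hA
    · exact h
  have hA2 : 2 ≤ A := Nat.le_of_dvd hA0 hAev.two_dvd
  have he0 : 0 < e := Nat.mul_pos (by omega) hA0
  have hqR : (q : ℝ) = (3 * R) ^ 2 := by
    rw [← hF, Nat.card_eq_fintype_card, hcard]
    push_cast
    rfl
  have hsq : Real.sqrt q = 3 * R := by
    rw [hqR, Real.sqrt_sq (by positivity)]
  have hpR : (0 : ℝ) < P := by exact_mod_cast hP.pos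
  have hMR : (0 : ℝ) < M := by exact_mod_cast hM0
  have hMP : (P : ℝ) ^ (m + 1) = P * M := by rw [pow_succ', hM]; push_cast; rfl
  have hMP' : (P : ℝ) ^ m = M := by rw [hM]; push_cast; rfl
  rw [pow_succ' P m, ← hM] at hA hqe
  -- Over ℝ, `A`, `e` and q are expressed through `R`, `P` and `M`, which reduces the closed
  -- formulas to field identities.
  have hAR : (A : ℝ) = (3 * R + 1) / (P * M) := by
    rw [eq_div_iff (by positivity)]
    have : ((3 * R + 1 : ℕ) : ℝ) = (P * M * A : ℕ) := by rw [hA]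
    push_cast at this
    linarith
  have heR : (e : ℝ) = (3 * R - 1) * A := by
    rw [he]
    push_cast [Nat.cast_sub (show 1 ≤ 3 * R by omega)]
    ring
  have hqeR : (q : ℝ) - 1 = P * M * e := by
    rw [heR, hAR, hqR]
    field_simp
    ring
  have hmod : ∀ a : ℤ, (P : ℤ) ≡ a [ZMOD 3] → (P : ℤ) % 3 = a % 3 := fun a h => h
  rw [hMP, hMP', hsq]
  have hmem : ∀ x, x ∈ Set.range d ↔ x ∈ definingSet F (P ^ (m + 1)) := fun x => by rw [hd]
  constructor
  · intro h1
    have h1' := hmod _ h1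
    have h3P : 3 ∣ P - 1 := by omega
    have hcop : Nat.Coprime 3 P := (Nat.Prime.coprime_iff_not_dvd Nat.prime_three).2 (by omega)
    have hD := fun x => (hmem x).trans (mem_definingSet_iff hP hcop hroot hrank (e := e)
      (by rw [hqe, pow_succ' P m]) x)
    simp only [h3P, and_true] at hD
    obtain ⟨hn, c1, c2, a, ha, c3, c4, c5⟩ := two_weight_of_compl_diff hinj hR0 hP.two_le hM0 hA2
      he0 hA hqe hce hcPe hw hD
    have haR : (a : ℝ) = 2 * R * (3 * R) + 2 * R * A - 2 * R * (P * A) := by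
      rw [eq_sub_iff_add_eq]
      exact_mod_cast ha
    have hnR : (n : ℝ) = P * M * e + e - P * e := by
      rw [eq_sub_iff_add_eq]
      exact_mod_cast hn
    have hbR : (weightCount (traceCode 3 d) (a + 2 * R) : ℝ) = P * e - e := by
      rw [eq_sub_iff_add_eq]
      exact_mod_cast c5
    refine ⟨?_, by rw [c1, hrank'], c2, a, a + 2 * R, ?_, ?_, c3, ?_, ?_⟩
    · rw [hnR, hqeR]
      field_simp
      ring
    · rw [haR, hAR, hqR]
      field_simp
      ring
    · push_cast
      rw [haR, hAR, hqR]
      field_simp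
      ring
    · rw [c4, hnR, hqeR]
      field_simp
      ring
    · rw [hbR, hqeR]
      field_simp
  · intro h1 h2
    have h1' := hmod _ h1
    have h3P : ¬ 3 ∣ P - 1 := by omega
    have hcop : Nat.Coprime 3 P := (Nat.Prime.coprime_iff_not_dvd Nat.prime_three).2 (by omega)
    have hD := fun x => (hmem x).trans (mem_definingSet_iff hP hcop hroot hrank (e := e)
      (by rw [hqe, pow_succ' P m]) x)
    simp only [h3P, and_false, imp_false] at hD
    -- The assumption `2 ≤ m` on the original exponent enters here; with `M = 1` the `P * e`-th
    -- roots of unity would fill F^* and D would be empty.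
    have hM3 : 3 ≤ M := hP3.trans (Nat.le_self_pow (by omega) P)
    obtain ⟨hn, c1, c2, b, hb, c3, c4, c5⟩ := two_weight_of_compl hinj hR0 hP.pos hM3 hA0
      he0 hA hqe hcPe (fun x hx => (hw x hx).2) hD
    have hbR : (b : ℝ) = 2 * R * (3 * R) - 2 * R * (P * A) := by
      rw [eq_sub_iff_add_eq]
      exact_mod_cast hb
    have hnR : (n : ℝ) = P * M * e - P * e := by
      rw [eq_sub_iff_add_eq]
      exact_mod_cast hn
    refine ⟨?_, by rw [c1, hrank'], c2, b + 2 * R, b, ?_, ?_, c3, ?_, ?_⟩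
    · rw [hnR, hqeR]
      field_simp
    · push_cast
      rw [hbR, hAR, hqR]
      field_simp
      ring
    · rw [hbR, hAR, hqR]
      field_simp
      ring
    · rw [c4, hqeR]
      push_cast
      field_simp
    · rw [c5, hnR, hqeR]
      field_simp
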